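/- For a group $G$, let $\Omega(G)$ be the set of all isomorphisms between subgroups of finite index of $G$. Call $\varphi_1:H_1\to H_1'$ and $\varphi_2:H_2\to H_2'$ in $\Omega(G)$ equivalent if there is a subgroup $H\leqslant H_1\cap H_2$ of finite index in $G$ with $\varphi_1|_H=\varphi_2|_H$. The abstract commensurator $\mathrm{Comm}(G)$ is the group of equivalence classes, with multiplication $[\alpha][\beta]=[\alpha\beta]$, where for $\alpha:G_1\to G_1'$ and $\beta:G_2\to G_2'$ the product $\alpha\beta:\alpha^{-1}(G_1'\cap G_2)\to\beta(G_1'\cap G_2)$ is $\alpha$ followed by $\beta$. A group $G$ has the unique root property if for all $x,y\in G$ and every positive integer $n$, $x^n=y^n$ implies $x=y$. Theorem. Let $A$ and $B$ be nontrivial groups with the unique root property, and suppose that at least one of them has finite quotients of arbitrarily large prime order (that is, for every $N$ it has a quotient group whose order is a prime greater than $N$). Then $\mathrm{Comm}(A*B)$, the abstract commensurator of the free product of $A$ and $B$, is not finitely generated. -/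

import Mathlib

/-- The set `Ω(G)` of all isomorphisms between subgroups of finite index of `G`. -/
structure FinIndexIso (G : Type*) [Group G] where
  dom : Subgroup G
  cod : Subgroup G
  dom_finiteIndex : dom.FiniteIndex
  cod_finiteIndex : cod.FiniteIndex
  toEquiv : dom ≃* cod

namespace FinIndexIso

variable {G : Type*} [Group G]

/-- The identity isomorphism of `G`. -/
def refl (G : Type*) [Group G] : FinIndexIso G where
  dom := ⊤
  cod := ⊤
  dom_finiteIndex := inferInstance
  cod_finiteIndex := inferInstance
  toEquiv := MulEquiv.refl _

/-- The inverse isomorphism. -/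
def symm (α : FinIndexIso G) : FinIndexIso G where
  dom := α.cod
  cod := α.dom
  dom_finiteIndex := α.cod_finiteIndex
  cod_finiteIndex := α.dom_finiteIndex
  toEquiv := α.toEquiv.symm

/-- The preimage `α⁻¹(α.cod ∩ K)`, as a subgroup of `G`. -/
def preimage (α : FinIndexIso G) (K : Subgroup G) : Subgroup G :=
  ((K.subgroupOf α.cod).comap α.toEquiv.toMonoidHom).map α.dom.subtype

theorem mem_preimage {α : FinIndexIso G} {K : Subgroup G} {x : G} :
    x ∈ α.preimage K ↔ ∃ h : x ∈ α.dom, (α.toEquiv ⟨x, h⟩ : G) ∈ K := by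
  constructor
  · rintro ⟨y, hy, rfl⟩
    exact ⟨y.2, hy⟩
  · rintro ⟨h, hx⟩
    exact ⟨⟨x, h⟩, hx, rfl⟩

theorem preimage_finiteIndex (α : FinIndexIso G) (K : Subgroup G) (hK : K.FiniteIndex) :
    (α.preimage K).FiniteIndex := by
  have := α.dom_finiteIndex
  refine ⟨?_⟩
  rw [preimage, Subgroup.index_map_subtype]
  refine mul_ne_zero ?_ Subgroup.FiniteIndex.index_ne_zero
  rw [Subgroup.index_comap_of_surjective _ α.toEquiv.surjective]
  exact Subgroup.FiniteIndex.index_ne_zero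

theorem symm_apply (α : FinIndexIso G) {x y : G} (hx : x ∈ α.dom) (hy : y ∈ α.cod)
    (h : (α.toEquiv ⟨x, hx⟩ : G) = y) : (α.toEquiv.symm ⟨y, hy⟩ : G) = x := by
  subst h
  exact congrArg Subtype.val (α.toEquiv.symm_apply_apply ⟨x, hx⟩)

theorem apply_symm (α : FinIndexIso G) {x y : G} (hx : x ∈ α.dom) (hy : y ∈ α.cod)
    (h : (α.toEquiv.symm ⟨y, hy⟩ : G) = x) : (α.toEquiv ⟨x, hx⟩ : G) = y := by
  subst h
  exact congrArg Subtype.val (α.toEquiv.apply_symm_apply ⟨y, hy⟩)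

theorem apply_mul (α : FinIndexIso G) {x y z : G} (hx : x ∈ α.dom) (hy : y ∈ α.dom)
    (hz : z ∈ α.dom) (h : z = x * y) :
    (α.toEquiv ⟨z, hz⟩ : G) = α.toEquiv ⟨x, hx⟩ * α.toEquiv ⟨y, hy⟩ := by
  subst h
  exact congrArg Subtype.val (map_mul α.toEquiv ⟨x, hx⟩ ⟨y, hy⟩)

/-- The product `αβ` of `α : G₁ → G₁'` and `β : G₂ → G₂'`, in which `α` is applied first: it is
the isomorphism `x ↦ β (α x)` from `α⁻¹(G₁' ∩ G₂)` onto `β(G₁' ∩ G₂)`. The latter subgroup is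
written as the preimage of `G₁' ∩ G₂` under `β⁻¹`. -/
def comp (α β : FinIndexIso G) : FinIndexIso G where
  dom := α.preimage β.dom
  cod := β.symm.preimage α.cod
  dom_finiteIndex := α.preimage_finiteIndex _ β.dom_finiteIndex
  cod_finiteIndex := β.symm.preimage_finiteIndex _ α.cod_finiteIndex
  toEquiv :=
    { toFun := fun x =>
        ⟨β.toEquiv ⟨α.toEquiv ⟨x, (mem_preimage.1 x.2).1⟩, (mem_preimage.1 x.2).2⟩,
          mem_preimage.2 ⟨Subtype.prop _,
            (β.symm_apply (mem_preimage.1 x.2).2 (Subtype.prop _) rfl).symm ▸ Subtype.prop _⟩⟩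
      invFun := fun y =>
        ⟨α.toEquiv.symm ⟨β.toEquiv.symm ⟨y, (mem_preimage.1 y.2).1⟩, (mem_preimage.1 y.2).2⟩,
          mem_preimage.2 ⟨Subtype.prop _,
            (α.apply_symm (Subtype.prop _) (mem_preimage.1 y.2).2 rfl).symm ▸ Subtype.prop _⟩⟩
      left_inv := fun x => Subtype.ext <|
        α.symm_apply (mem_preimage.1 x.2).1 _ (β.symm_apply (mem_preimage.1 x.2).2 _ rfl).symm
      right_inv := fun y => Subtype.ext <|
        β.apply_symm _ (mem_preimage.1 y.2).1
          (α.apply_symm (Subtype.prop _) (mem_preimage.1 y.2).2 rfl).symm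
      map_mul' := fun x y => Subtype.ext <|
        β.apply_mul (mem_preimage.1 x.2).2 (mem_preimage.1 y.2).2 _
          (α.apply_mul (mem_preimage.1 x.2).1 (mem_preimage.1 y.2).1 _ rfl) }

/-- Two isomorphisms are equivalent if both are defined and agree on some subgroup of finite
index of `G`. -/
def Rel (α β : FinIndexIso G) : Prop :=
  ∃ H : Subgroup G, H.FiniteIndex ∧ ∃ (hα : H ≤ α.dom) (hβ : H ≤ β.dom),
    ∀ x (hx : x ∈ H), (α.toEquiv ⟨x, hα hx⟩ : G) = β.toEquiv ⟨x, hβ hx⟩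

theorem Rel.refl (α : FinIndexIso G) : α.Rel α :=
  ⟨α.dom, α.dom_finiteIndex, le_rfl, le_rfl, fun _ _ => rfl⟩

theorem Rel.symm {α β : FinIndexIso G} : α.Rel β → β.Rel α :=
  fun ⟨H, hH, h1, h2, h⟩ => ⟨H, hH, h2, h1, fun x hx => (h x hx).symm⟩

theorem Rel.trans {α β γ : FinIndexIso G} : α.Rel β → β.Rel γ → α.Rel γ := by
  rintro ⟨H, hH, h1, h2, h⟩ ⟨K, hK, k1, k2, k⟩
  exact ⟨H ⊓ K, inferInstance, inf_le_left.trans h1, inf_le_right.trans k2,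
    fun x hx => (h x hx.1).trans (k x hx.2)⟩

theorem Rel.comp {α α' β β' : FinIndexIso G} :
    α.Rel α' → β.Rel β' → (α.comp β).Rel (α'.comp β') := by
  rintro ⟨H, hH, h1, h2, h⟩ ⟨K, hK, k1, k2, k⟩
  have key : ∀ x ∈ H ⊓ α.preimage K, ∃ (hx : x ∈ α.dom) (hx' : x ∈ α'.dom),
      (α.toEquiv ⟨x, hx⟩ : G) = α'.toEquiv ⟨x, hx'⟩ ∧ (α.toEquiv ⟨x, hx⟩ : G) ∈ K := by
    rintro x ⟨hx, hx'⟩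
    exact ⟨h1 hx, h2 hx, h x hx, (mem_preimage.1 hx').2⟩
  have := α.preimage_finiteIndex K hK
  refine ⟨H ⊓ α.preimage K, inferInstance, fun x hx => ?_, fun x hx => ?_, fun x hx => ?_⟩
  · obtain ⟨a, b, c, d⟩ := key x hx
    exact mem_preimage.2 ⟨a, k1 d⟩
  · obtain ⟨a, b, c, d⟩ := key x hx
    exact mem_preimage.2 ⟨b, k2 (c ▸ d)⟩
  · obtain ⟨a, b, c, d⟩ := key x hx
    refine (k _ d).trans ?_
    change (β'.toEquiv ⟨(α.toEquiv ⟨x, a⟩ : G), k2 d⟩ : G) =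
      β'.toEquiv ⟨α'.toEquiv ⟨x, b⟩, k2 (c ▸ d)⟩
    congr 2
    exact Subtype.ext c

theorem Rel.inv {α β : FinIndexIso G} : α.Rel β → α.symm.Rel β.symm := by
  rintro ⟨H, hH, h1, h2, h⟩
  have key : ∀ y ∈ α.symm.preimage H, ∃ x, ∃ hx : x ∈ H,
      (α.toEquiv ⟨x, h1 hx⟩ : G) = y ∧ (β.toEquiv ⟨x, h2 hx⟩ : G) = y := by
    intro y hy
    obtain ⟨a, b⟩ := mem_preimage.1 hy
    have e : (α.toEquiv ⟨_, h1 b⟩ : G) = y :=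
      congrArg Subtype.val (α.toEquiv.apply_symm_apply ⟨y, a⟩)
    exact ⟨_, b, e, (h _ b).symm.trans e⟩
  refine ⟨α.symm.preimage H, α.symm.preimage_finiteIndex H hH, fun y hy => ?_, fun y hy => ?_,
    fun y hy => ?_⟩
  · exact (mem_preimage.1 hy).1
  · obtain ⟨x, hx, -, e⟩ := key y hy
    exact e ▸ (β.toEquiv ⟨x, h2 hx⟩).2
  · obtain ⟨x, hx, e, e'⟩ := key y hy
    subst e
    have e1 : α.symm.toEquiv ⟨_, (α.toEquiv ⟨x, h1 hx⟩).2⟩ = ⟨x, h1 hx⟩ :=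
      α.toEquiv.symm_apply_apply _
    have e2 : β.symm.toEquiv ⟨_, (β.toEquiv ⟨x, h2 hx⟩).2⟩ = ⟨x, h2 hx⟩ :=
      β.toEquiv.symm_apply_apply _
    rw [e1]
    have e3 : (⟨_, (β.toEquiv ⟨x, h2 hx⟩).2⟩ : β.cod) =
        ⟨(α.toEquiv ⟨x, h1 hx⟩ : G), e' ▸ (β.toEquiv ⟨x, h2 hx⟩).2⟩ := Subtype.ext e'
    exact (congrArg Subtype.val e2).symm.trans
      (congrArg (fun z => (β.symm.toEquiv z : G)) e3)

theorem Rel.comp_assoc (α β γ : FinIndexIso G) :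
    ((α.comp β).comp γ).Rel (α.comp (β.comp γ)) := by
  refine ⟨((α.comp β).comp γ).dom, ((α.comp β).comp γ).dom_finiteIndex, le_rfl,
    fun x hx => ?_, fun x hx => rfl⟩
  obtain ⟨h1, h2⟩ := mem_preimage.1 hx
  obtain ⟨h3, h4⟩ := mem_preimage.1 h1
  exact mem_preimage.2 ⟨h3, mem_preimage.2 ⟨h4, h2⟩⟩

theorem Rel.refl_comp (α : FinIndexIso G) : ((FinIndexIso.refl G).comp α).Rel α :=
  ⟨α.dom, α.dom_finiteIndex, fun _ hx => mem_preimage.2 ⟨trivial, hx⟩, le_rfl, fun _ _ => rfl⟩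

theorem Rel.comp_refl (α : FinIndexIso G) : (α.comp (FinIndexIso.refl G)).Rel α :=
  ⟨α.dom, α.dom_finiteIndex, fun _ hx => mem_preimage.2 ⟨hx, trivial⟩, le_rfl, fun _ _ => rfl⟩

theorem Rel.symm_comp (α : FinIndexIso G) : (α.symm.comp α).Rel (FinIndexIso.refl G) :=
  ⟨α.cod, α.cod_finiteIndex, fun _ hx => mem_preimage.2 ⟨hx, Subtype.prop _⟩, le_top,
    fun x hx => congrArg Subtype.val (α.toEquiv.apply_symm_apply ⟨x, hx⟩)⟩

/-- The equivalence relation on `Ω(G)`. -/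
instance setoid (G : Type*) [Group G] : Setoid (FinIndexIso G) where
  r := Rel
  iseqv := ⟨Rel.refl, Rel.symm, Rel.trans⟩

end FinIndexIso

/-- The abstract commensurator `Comm(G)`: equivalence classes of isomorphisms between subgroups
of finite index of `G`. -/
def AbstractCommensurator (G : Type*) [Group G] : Type _ :=
  Quotient (FinIndexIso.setoid G)

namespace AbstractCommensurator

/-- The group structure of `Comm(G)`, given by `[α][β] = [αβ]`. -/
instance instGroup (G : Type*) [Group G] : Group (AbstractCommensurator G) where
  mul := Quotient.map₂ FinIndexIso.comp fun _ _ h _ _ h' => FinIndexIso.Rel.comp h h'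
  one := Quotient.mk _ (FinIndexIso.refl G)
  inv := Quotient.map FinIndexIso.symm fun _ _ h => FinIndexIso.Rel.inv h
  mul_assoc := by
    rintro ⟨α⟩ ⟨β⟩ ⟨γ⟩
    exact Quotient.sound (FinIndexIso.Rel.comp_assoc α β γ)
  one_mul := by
    rintro ⟨α⟩
    exact Quotient.sound (FinIndexIso.Rel.refl_comp α)
  mul_one := by
    rintro ⟨α⟩
    exact Quotient.sound (FinIndexIso.Rel.comp_refl α)
  inv_mul_cancel := by
    rintro ⟨α⟩
    exact Quotient.sound (FinIndexIso.Rel.symm_comp α)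

end AbstractCommensurator

/-- `G` has the unique root property: for all `x, y ∈ G` and every positive integer `n`,
the equality `xⁿ = yⁿ` implies `x = y`. -/
def HasUniqueRoots (G : Type*) [Group G] : Prop :=
  ∀ (x y : G) (n : ℕ), 0 < n → x ^ n = y ^ n → x = y

/-- The unique root property is what Mathlib calls `IsMulTorsionFree`. -/
theorem hasUniqueRoots_iff_isMulTorsionFree (G : Type*) [Group G] :
    HasUniqueRoots G ↔ IsMulTorsionFree G :=
  ⟨fun h => ⟨fun n hn x y hxy => h x y n (Nat.pos_of_ne_zero hn) hxy⟩,
    fun h _ _ _ hn hxy => h.pow_left_injective hn.ne' hxy⟩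

/-- `G` has finite quotients of arbitrarily large prime order. -/
def HasArbitrarilyLargePrimeQuotients (G : Type*) [Group G] : Prop :=
  ∀ N : ℕ, ∃ K : Subgroup G, K.Normal ∧ (Nat.card (G ⧸ K)).Prime ∧ N < Nat.card (G ⧸ K)

/-! If `Comm(G)` is finitely generated and a prime p exceeds all indices attached to representatives
of the generators, every class has a representative α whose domain contains, for each x, some x ^ m
with m prime to p (`primeTo_eq_top_of_fg`). An automorphism F of a finite-index subgroup containing
x ^ p must then send it to an element which, up to exponents prime to p, has the p-th root α (x ^
m). It suffices to violate this for arbitrarily large p (`DestroysRoot.primeTo_ne_top`).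

Let ρ : A → Q be onto a group of prime order p > 2. The kernel of A ∗ B → Q is the free product of
ker ρ and p conjugates of B. Choose a outside ker ρ and b ≠ 1, and let F conjugate the factor B
alone by c = a ^ p (`twistKer`). It sends (ab) ^ p to (ab) ^ (p - 1) a c b c⁻¹. The restricted
wreath product of A and B again has unique roots, which removes the auxiliary exponents, and there
the image has no p-th root (`not_isPow_of_finiteSupport`). -/

/-! ### Automorphisms of the kernel of A ∗ B → Q -/

section Twist

open Monoid Coprod

variable {A B Q : Type*} [Group A] [Group B] [Group Q]

open Classical in
/-- The homomorphism `A ∗ B → (A ∗ B) ≀ Q` which is `a ↦ (a, …, a; ρ a)` on `A`, and which on `B`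
conjugates by `c` in the coordinate `1` only. -/
noncomputable def twist (ρ : A →* Q) (c : A) : A ∗ B →* (A ∗ B) ≀ᵣ Q :=
  Coprod.lift
    { toFun := fun a => ⟨fun _ => inl a, ρ a⟩
      map_one' := by ext <;> simp
      map_mul' := fun a a' => by ext <;> simp }
    { toFun := fun b => ⟨fun q => if q = 1 then inl c * inr b * (inl c)⁻¹ else inr b, 1⟩
      map_one' := by ext <;> simp
      map_mul' := fun b b' => by
        ext q
        · simp only [RegularWreathProduct.mul_left, Pi.mul_apply, inv_one, one_mul]
          split_ifs <;> simp [mul_assoc]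
        · simp }

/-- The homomorphism `A ∗ B → Q` extending `ρ : A → Q` and killing `B`. -/
def killRight (ρ : A →* Q) : A ∗ B →* Q := Coprod.lift ρ 1

theorem twist_right (ρ : A →* Q) (c : A) (g : A ∗ B) : (twist ρ c g).right = killRight ρ g :=
  DFunLike.congr_fun (f := RegularWreathProduct.rightHom.comp (twist ρ c)) (g := killRight ρ)
    (Coprod.hom_ext rfl rfl) g

/-- The shift disappears when g lies in the kernel, so there each coordinate is multiplicative. -/
theorem twist_mul_left (ρ : A →* Q) (c : A) (g h : A ∗ B) (q : Q) :
    (twist ρ c (g * h)).left q =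
      (twist ρ c g).left q * (twist ρ c h).left ((killRight ρ g)⁻¹ * q) := by
  rw [map_mul, RegularWreathProduct.mul_left, Pi.mul_apply, twist_right]

theorem twist_inl_left (ρ : A →* Q) (c a : A) (q : Q) :
    (twist ρ c (inl a : A ∗ B)).left q = inl a := rfl

theorem twist_inr_left_one (ρ : A →* Q) (c : A) (b : B) :
    (twist ρ c (inr b : A ∗ B)).left 1 = inl c * inr b * (inl c)⁻¹ := if_pos rfl

theorem twist_inr_left_of_ne (ρ : A →* Q) (c : A) (b : B) {q : Q} (hq : q ≠ 1) :
    (twist ρ c (inr b : A ∗ B)).left q = inr b := if_neg hq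

theorem killRight_twist (ρ : A →* Q) (c : A) (g : A ∗ B) (q : Q) :
    killRight ρ ((twist ρ c g).left q) = killRight ρ g := by
  induction g using Coprod.induction_on generalizing q with
  | inl a => rfl
  | inr b =>
    by_cases hq : q = 1
    · subst hq
      simp [twist_inr_left_one, killRight]
    · rw [twist_inr_left_of_ne ρ c b hq]
  | mul g h hg hh => rw [twist_mul_left, map_mul, map_mul, hg, hh]

/-- Since c dies in Q, the inserted letters c and c⁻¹ move no coordinate, so the second twist meets
the same occurrences of B as the first and undoes it. -/
theorem twist_twist_inv (ρ : A →* Q) {c : A} (hc : ρ c = 1) (g : A ∗ B) (q : Q) :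
    (twist ρ c⁻¹ ((twist ρ c g).left q)).left q = g := by
  induction g using Coprod.induction_on generalizing q with
  | inl a => rfl
  | inr b =>
    by_cases hq : q = 1
    · subst hq
      rw [twist_inr_left_one, twist_mul_left, twist_mul_left, ← map_inv (inl : A →* A ∗ B), twist_inl_left,
        twist_inl_left]
      simp [killRight, hc, twist_inr_left_one, mul_assoc]
    · rw [twist_inr_left_of_ne ρ c b hq, twist_inr_left_of_ne ρ _ b hq]
  | mul g h hg hh => rw [twist_mul_left, twist_mul_left, killRight_twist, hg, hh]

/-- The coordinate `1` of `twist ρ c` restricts to an automorphism of the kernel of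
`killRight ρ`. -/
noncomputable def twistKer (ρ : A →* Q) {c : A} (hc : ρ c = 1) :
    (killRight ρ : A ∗ B →* Q).ker ≃* (killRight ρ : A ∗ B →* Q).ker where
  toFun k := ⟨(twist ρ c (k : A ∗ B)).left 1, (killRight_twist ρ c _ _).trans k.2⟩
  invFun k := ⟨(twist ρ c⁻¹ (k : A ∗ B)).left 1, (killRight_twist ρ c⁻¹ _ _).trans k.2⟩
  left_inv k := Subtype.ext (twist_twist_inv ρ hc _ _)
  right_inv k := Subtype.ext <| by
    have := twist_twist_inv ρ (c := c⁻¹) (by rw [map_inv, hc, inv_one]) (k : A ∗ B) 1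
    rwa [inv_inv] at this
  map_mul' k l := Subtype.ext <| by
    change (twist ρ c ((k : A ∗ B) * (l : A ∗ B))).left 1 =
      (twist ρ c (k : A ∗ B)).left 1 * (twist ρ c (l : A ∗ B)).left 1
    rw [twist_mul_left, MonoidHom.mem_ker.1 k.2, inv_one, one_mul]

/-- Each letter a multiplies the coordinate by (ρ a)⁻¹, and below the order of ρ a no b is read at
coordinate 1. -/
theorem twist_pow_left (ρ : A →* Q) (c a : A) (b : B) (n k : ℕ) (hk : k + n < orderOf (ρ a)) :
    (twist ρ c ((inl a * inr b : A ∗ B) ^ n)).left ((ρ a)⁻¹ ^ k) = (inl a * inr b) ^ n := by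
  induction n generalizing k with
  | zero => simp
  | succ n ih =>
    have hne : (ρ a)⁻¹ * (ρ a)⁻¹ ^ k ≠ 1 := by
      rw [← pow_succ', inv_pow, Ne, inv_eq_one]
      exact pow_ne_one_of_lt_orderOf (by omega) (by omega)
    have hkill : killRight ρ (inl a * inr b : A ∗ B) = ρ a := by simp [killRight]
    have hkill' : killRight ρ (inl a : A ∗ B) = ρ a := by simp [killRight]
    rw [pow_succ', twist_mul_left, twist_mul_left, twist_inl_left, hkill, hkill',
      twist_inr_left_of_ne _ _ _ hne, ← pow_succ' _ k, ih _ (by omega)]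

/-- Only the last b is read at coordinate 1, so it alone is conjugated. -/
theorem twist_pow_orderOf_left (ρ : A →* Q) (c a : A) (b : B) (n : ℕ)
    (hn : orderOf (ρ a) = n + 1) :
    (twist ρ c ((inl a * inr b : A ∗ B) ^ (n + 1))).left 1 =
      (inl a * inr b) ^ n * (inl (a * c) * inr b * inl c⁻¹) := by
  have hkill : killRight ρ ((inl a * inr b : A ∗ B) ^ n) = (ρ a)⁻¹ := by
    rw [map_pow, eq_inv_iff_mul_eq_one]
    simp only [killRight, map_mul, Coprod.lift_apply_inl, Coprod.lift_apply_inr,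
      MonoidHom.one_apply, mul_one]
    rw [← pow_succ, ← hn, pow_orderOf_eq_one]
  have h := twist_pow_left ρ c a b n 0 (by omega)
  rw [pow_zero] at h
  rw [pow_succ, twist_mul_left, h, twist_mul_left, hkill, twist_inl_left]
  simp [killRight, twist_inr_left_one, mul_assoc]

end Twist

/-! ### Roots in the restricted wreath product -/

section Wreath

open Monoid Coprod

variable {A B : Type*} [Group A] [Group B]

/-- The restricted wreath product: the elements of `A ≀ B` of finite support. -/
def finiteSupportWreath (A B : Type*) [Group A] [Group B] : Subgroup (A ≀ᵣ B) where
  carrier := {u | u.left.mulSupport.Finite}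
  one_mem' := by simp
  mul_mem' {u v} hu hv := by
    refine (hu.union (hv.image (u.right * ·))).subset fun x hx => ?_
    by_contra h
    simp only [Set.mem_union, Function.mem_mulSupport, not_or, not_not, Set.mem_image, not_exists,
      not_and] at h
    refine hx ?_
    have h2 : v.left (u.right⁻¹ * x) = 1 := by
      by_contra h3
      exact h.2 _ h3 (mul_inv_cancel_left _ _)
    simp [h.1, h2]
  inv_mem' {u} hu := by
    refine (hu.image (u.right⁻¹ * ·)).subset fun x hx => ⟨u.right * x, fun h => hx ?_, by simp⟩
    simp [h]

theorem mem_finiteSupportWreath {u : A ≀ᵣ B} :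
    u ∈ finiteSupportWreath A B ↔ u.left.mulSupport.Finite := Iff.rfl

theorem RegularWreathProduct.right_pow (u : A ≀ᵣ B) (n : ℕ) : (u ^ n).right = u.right ^ n :=
  map_pow RegularWreathProduct.rightHom u n

/-- A function of finite support whose support is invariant under an element of infinite order
is trivial. -/
theorem eq_one_of_mulSupport_finite [IsMulTorsionFree B] {f : B → A} {β : B} (hβ : β ≠ 1)
    (hf : f.mulSupport.Finite) {x : B}
    (h : ∀ n : ℕ, f (β ^ n * x) ≠ 1 → f (β ^ (n + 1) * x) ≠ 1) : f x = 1 := by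
  by_contra hx
  have hmem : ∀ n : ℕ, β ^ n * x ∈ f.mulSupport := by
    intro n
    induction n with
    | zero => simpa using hx
    | succ n ih => exact h n ih
  refine Set.infinite_of_injective_forall_mem (f := fun n : ℕ => β ^ n * x) ?_ hmem hf
  intro m n hmn
  exact IsMulTorsionFree.pow_right_injective hβ (mul_right_cancel hmn)

instance [IsMulTorsionFree A] [IsMulTorsionFree B] :
    IsMulTorsionFree (finiteSupportWreath A B) where
  pow_left_injective n hn := by
    rintro ⟨u, hu⟩ ⟨v, hv⟩ huv
    have huv : u ^ n = v ^ n := congrArg Subtype.val huv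
    have hr : u.right = v.right := by
      refine pow_left_injective hn ?_
      simpa [RegularWreathProduct.right_pow] using congrArg RegularWreathProduct.right huv
    obtain ⟨d, hd⟩ : ∃ d, d = u * v⁻¹ := ⟨_, rfl⟩
    have hd1 : d.right = 1 := by simp [hd, hr]
    have hdS : d ∈ finiteSupportWreath A B := hd ▸ mul_mem hu (inv_mem hv)
    have huw : u * v ^ n = v ^ n * u := by rw [← huv, ← pow_succ', ← pow_succ]
    have hvw : v⁻¹ * v ^ n = v ^ n * v⁻¹ := ((Commute.refl v).inv_left.pow_right n).eq
    -- The base element d commutes with v ^ n, so its finite support is invariant under translation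
    -- by v.right ^ n; this forces d = 1 unless v.right = 1, where roots are compared
    -- coordinatewise.
    have hdw : d * v ^ n = v ^ n * d := by
      rw [hd, mul_assoc, hvw, ← mul_assoc, huw, mul_assoc]
    suffices d = 1 by
      exact Subtype.ext (mul_inv_eq_one.1 (hd ▸ this))
    refine RegularWreathProduct.ext ?_ hd1
    funext x
    by_cases hv1 : v.right = 1
    · have hpow : ∀ w : A ≀ᵣ B, w.right = 1 → ∀ k : ℕ, (w ^ k).left x = w.left x ^ k := by
        intro w hw k
        induction k with
        | zero => simp
        | succ k ih => simp [pow_succ', hw, ih]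
      have h := congrArg (fun w : A ≀ᵣ B => w.left x) huv
      simp only [hpow u (hr.trans hv1), hpow v hv1] at h
      have := pow_left_injective hn h
      simp [hd, hr, hv1, this]
    · refine eq_one_of_mulSupport_finite (β := (v.right ^ n)) (fun h => hv1 ?_) hdS fun k hk => ?_
      · exact pow_left_injective hn (h.trans (one_pow n).symm)
      · intro h
        refine hk ?_
        have h2 := congrArg (fun w : A ≀ᵣ B => w.left ((v.right ^ n) ^ (k + 1) * x)) hdw
        simp only [RegularWreathProduct.mul_left, Pi.mul_apply, hd1,
          RegularWreathProduct.right_pow, h, inv_one, one_mul] at h2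
        rw [pow_succ' _ k, mul_assoc, inv_mul_cancel_left] at h2
        exact (mul_eq_left.1 h2.symm)

/-- Both y and its conjugate by z are m-th roots of y ^ m, so y and z commute; Bézout then gives the
root. -/
theorem exists_pow_eq_of_pow_eq_pow {S : Type*} [Group S] [IsMulTorsionFree S] {y z : S} {p m : ℕ}
    (hm : m ≠ 0) (hp : m.Coprime p) (h : z ^ p = y ^ m) : ∃ w, w ^ p = y := by
  have hc : Commute z y := by
    have h1 : Commute z (y ^ m) := h ▸ Commute.self_pow z p
    have h2 : (z * y * z⁻¹) ^ m = y ^ m := by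
      rw [conj_pow, h1.eq, mul_inv_cancel_right]
    have h3 := pow_left_injective hm h2
    exact mul_inv_eq_iff_eq_mul.1 h3
  refine ⟨z ^ (m.gcdA p) * y ^ (m.gcdB p), ?_⟩
  have h4 : ((1 : ℕ) : ℤ) = m * m.gcdA p + p * m.gcdB p := by
    rw [← Nat.gcd_eq_gcd_ab, hp]
  rw [(hc.zpow_zpow _ _).mul_pow, ← zpow_natCast, ← zpow_natCast, ← zpow_mul, ← zpow_mul,
    mul_comm, zpow_mul, zpow_natCast, h, ← zpow_natCast, ← zpow_mul, mul_comm _ (p : ℤ),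
    ← zpow_add, ← h4, Nat.cast_one, zpow_one]

open Classical in
/-- The homomorphism from the free product to the wreath product. -/
noncomputable def coprodToWreath (A B : Type*) [Group A] [Group B] : A ∗ B →* A ≀ᵣ B :=
  Coprod.lift
    { toFun := fun a => ⟨Pi.mulSingle 1 a, 1⟩
      map_one' := RegularWreathProduct.ext (Pi.mulSingle_one 1) rfl
      map_mul' := fun a a' => by ext <;> simp [Pi.mulSingle_mul] }
    RegularWreathProduct.inl

theorem coprodToWreath_mem (g : A ∗ B) : coprodToWreath A B g ∈ finiteSupportWreath A B := by
  classical
  induction g using Coprod.induction_on with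
  | inl a =>
    refine (Set.finite_singleton (1 : B)).subset fun x hx => ?_
    by_contra h
    exact hx (Pi.mulSingle_eq_of_ne (M := fun _ : B => A) h a)
  | inr b =>
    rw [mem_finiteSupportWreath]
    convert Set.finite_empty
    exact Function.mulSupport_one
  | mul g h hg hh => rw [map_mul]; exact mul_mem hg hh

theorem coprodToWreath_inl_left_one (a : A) : (coprodToWreath A B (inl a)).left 1 = a := by
  classical
  exact Pi.mulSingle_eq_same (M := fun _ : B => A) 1 a

theorem coprodToWreath_inl_left_of_ne (a : A) {x : B} (hx : x ≠ 1) :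
    (coprodToWreath A B (inl a)).left x = 1 := by
  classical
  exact Pi.mulSingle_eq_of_ne (M := fun _ : B => A) hx a

theorem coprodToWreath_inl_right (a : A) : (coprodToWreath A B (inl a)).right = 1 := rfl

theorem coprodToWreath_inr (b : B) :
    coprodToWreath A B (inr b) = RegularWreathProduct.inl b := rfl

theorem coprodToWreath_pow_right (a : A) (b : B) (n : ℕ) :
    (coprodToWreath A B ((inl a * inr b) ^ n)).right = b ^ n := by
  rw [map_pow, RegularWreathProduct.right_pow, map_mul, RegularWreathProduct.mul_right,
    coprodToWreath_inl_right, one_mul, coprodToWreath_inr, RegularWreathProduct.right_inl]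

theorem coprodToWreath_pow_left [IsMulTorsionFree B] (a : A) {b : B} (hb : b ≠ 1) (n : ℕ) (k : ℤ) :
    (coprodToWreath A B ((inl a * inr b) ^ n)).left (b ^ k) = if 0 ≤ k ∧ k < n then a else 1 := by
  have hinj : ∀ j : ℤ, b ^ j = 1 ↔ j = 0 := fun j =>
    IsMulTorsionFree.zpow_eq_one_iff_right hb
  induction n with
  | zero =>
    rw [if_neg (by omega)]
    simp
  | succ n ih =>
    rw [pow_succ, map_mul, RegularWreathProduct.mul_left, Pi.mul_apply, ih,
      coprodToWreath_pow_right, map_mul, RegularWreathProduct.mul_left, coprodToWreath_inr,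
      ← zpow_natCast, ← zpow_neg, ← zpow_add, RegularWreathProduct.left_inl]
    by_cases h : k = n
    · subst h
      simp [coprodToWreath_inl_left_one]
    · have h1 : b ^ (-(n : ℤ) + k) ≠ 1 := fun h2 => h (by have := (hinj _).1 h2; omega)
      rw [Pi.mul_apply, coprodToWreath_inl_left_of_ne _ h1]
      by_cases h3 : 0 ≤ k ∧ k < n
      · rw [if_pos h3, if_pos (by push_cast; omega)]; simp
      · rw [if_neg h3, if_neg (by push_cast; omega)]; simp

/-- The element `(ab)ⁿ a c b c⁻¹` has no `(n + 1)`-st root of finite support. -/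
theorem not_isPow_of_finiteSupport [IsMulTorsionFree B] {a c : A} (hc : c ≠ 1) {b : B}
    (hb : b ≠ 1) {n : ℕ} (hn : 2 ≤ n) {w : A ≀ᵣ B} (hw : w ∈ finiteSupportWreath A B) :
    w ^ (n + 1) ≠
      coprodToWreath A B ((inl a * inr b) ^ n * (inl (a * c) * inr b * inl c⁻¹)) := by
  intro h
  have hinj : ∀ j : ℤ, b ^ j = 1 ↔ j = 0 := fun j =>
    IsMulTorsionFree.zpow_eq_one_iff_right hb
  obtain ⟨Y, hY⟩ : ∃ Y, Y = coprodToWreath A B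
    ((inl a * inr b) ^ n * (inl (a * c) * inr b * inl c⁻¹)) := ⟨_, rfl⟩
  rw [← hY] at h
  have hYr : Y.right = b ^ (n + 1) := by
    rw [hY, map_mul, RegularWreathProduct.mul_right, coprodToWreath_pow_right]
    simp [coprodToWreath_inl_right, coprodToWreath_inr, pow_succ]
  -- Along the powers of b, Y reads a, …, a (n times), then ac, then c⁻¹.
  have hYl : ∀ k : ℤ, Y.left (b ^ k) = (if 0 ≤ k ∧ k < n then a else 1) *
      ((if k = n then a * c else 1) * (if k = n + 1 then c⁻¹ else 1)) := by
    intro k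
    rw [hY, map_mul, RegularWreathProduct.mul_left, Pi.mul_apply, coprodToWreath_pow_left a hb,
      coprodToWreath_pow_right]
    congr 1
    rw [map_mul, map_mul, RegularWreathProduct.mul_left, RegularWreathProduct.mul_left,
      RegularWreathProduct.mul_right, coprodToWreath_inr, coprodToWreath_inl_right, one_mul,
      RegularWreathProduct.right_inl, RegularWreathProduct.left_inl, ← zpow_natCast, ← zpow_neg,
      ← zpow_add, Pi.mul_apply, Pi.mul_apply, Pi.one_apply, mul_one, ← zpow_neg_one b, ← zpow_add]
    congr 1
    · split_ifs with h1
      · rw [(hinj _).2 (by omega), coprodToWreath_inl_left_one]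
      · exact coprodToWreath_inl_left_of_ne _ fun h2 => h1 (by have := (hinj _).1 h2; omega)
    · split_ifs with h1
      · rw [(hinj _).2 (by omega), coprodToWreath_inl_left_one]
      · exact coprodToWreath_inl_left_of_ne _ fun h2 => h1 (by have := (hinj _).1 h2; omega)
  have hwr : w.right = b := by
    refine pow_left_injective (Nat.succ_ne_zero n) ?_
    simpa [RegularWreathProduct.right_pow, hYr] using congrArg RegularWreathProduct.right h
  have hcomm : w * Y = Y * w := by rw [← h, ← pow_succ', ← pow_succ]
  have hk : ∀ k : ℤ, w.left (b ^ k) * Y.left (b ^ (k - 1)) =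
      Y.left (b ^ k) * w.left (b ^ (k - (n + 1))) := by
    intro k
    have := congrArg (fun v : A ≀ᵣ B => v.left (b ^ k)) hcomm
    simp only [RegularWreathProduct.mul_left, Pi.mul_apply, hwr, hYr] at this
    rw [← zpow_natCast, ← zpow_neg, ← zpow_neg_one, ← zpow_add, ← zpow_add] at this
    convert this using 4 <;> push_cast <;> ring
  have hY1 : ∀ k : ℤ, k < 0 ∨ n + 1 < k → Y.left (b ^ k) = 1 := by
    intro k hk
    rw [hYl, if_neg (by omega), if_neg (by omega), if_neg (by omega)]
    simp
  -- Away from the support of Y, commutation makes w periodic with step n + 1; finite support then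
  -- kills w at exponents k ≥ 2 and k < 0.
  have hper : ∀ k : ℤ, k < 0 ∨ n + 2 < k → w.left (b ^ k) = w.left (b ^ (k - (n + 1))) := by
    intro k hk'
    have := hk k
    rwa [hY1 k (by omega), hY1 (k - 1) (by omega), mul_one, one_mul] at this
  have hpos : ∀ k : ℤ, 2 ≤ k → w.left (b ^ k) = 1 := by
    intro k hk2
    refine eq_one_of_mulSupport_finite (β := b ^ (n + 1 : ℤ))
      (fun h => by have := (hinj _).1 h; omega) hw fun j hj => ?_
    rw [← zpow_natCast, ← zpow_mul, ← zpow_add] at hj ⊢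
    have h0 : (0 : ℤ) ≤ (n + 1) * j := by positivity
    rw [hper _ (Or.inr (by push_cast; nlinarith))]
    convert hj using 3
    push_cast; ring
  have hneg : ∀ k : ℤ, k < 0 → w.left (b ^ k) = 1 := by
    intro k hk2
    refine eq_one_of_mulSupport_finite (β := b ^ (-(n + 1) : ℤ))
      (fun h => by have := (hinj _).1 h; omega) hw fun j hj => ?_
    rw [← zpow_natCast, ← zpow_mul, ← zpow_add] at hj ⊢
    have h0 : (0 : ℤ) ≤ (n + 1) * j := by positivity
    rw [hper _ (Or.inl (by nlinarith))] at hj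
    convert hj using 3
    push_cast; ring
  -- Splitting Y as w * w ^ n and as w ^ n * w equates its values ac and a at consecutive places; `2
  -- ≤ n` ensures that w vanishes at b ^ n.
  have hR1 : Y.left (b ^ (n : ℤ)) = (w ^ n).left (b ^ (n - 1 : ℤ)) := by
    rw [← h, pow_succ', RegularWreathProduct.mul_left, Pi.mul_apply, hpos _ (by omega), one_mul,
      hwr, ← zpow_neg_one, ← zpow_add, neg_add_eq_sub]
  have hR2 : Y.left (b ^ (n - 1 : ℤ)) = (w ^ n).left (b ^ (n - 1 : ℤ)) := by
    rw [← h, pow_succ, RegularWreathProduct.mul_left, Pi.mul_apply,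
      RegularWreathProduct.right_pow, hwr, ← zpow_natCast b, ← zpow_neg, ← zpow_add,
      hneg _ (by omega), mul_one]
  have := hR1.trans hR2.symm
  rw [hYl, hYl, if_neg (by omega), if_pos rfl, if_neg (by omega), if_pos (by omega),
    if_neg (by omega), if_neg (by omega)] at this
  exact hc (by simpa using this)

end Wreath

/-! ### Finite generation and exponents prime to p -/

section Commensurator

variable {G : Type*} [Group G]

/-- Every element of `G` has a power with exponent prime to `p` in `H`. -/
def Subgroup.IsPrimeToPowFull (H : Subgroup G) (p : ℕ) : Prop :=
  ∀ x : G, ∃ m : ℕ, m.Coprime p ∧ x ^ m ∈ H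

theorem Subgroup.isPrimeToPowFull_of_index_lt {H : Subgroup G} (hH : H.FiniteIndex) {p : ℕ}
    (hp : p.Prime) (h : H.index < p) : H.IsPrimeToPowFull p := by
  intro x
  obtain ⟨m, h0, hle, hm⟩ := Subgroup.exists_pow_mem_of_index_ne_zero hH.index_ne_zero x
  exact ⟨m, (Nat.coprime_of_lt_prime h0.ne' (hle.trans_lt h) hp).symm, hm⟩

namespace FinIndexIso

theorem apply_pow (α : FinIndexIso G) {x : G} (hx : x ∈ α.dom) (n : ℕ) {z : G} (hz : z ∈ α.dom)
    (h : z = x ^ n) : (α.toEquiv ⟨z, hz⟩ : G) = (α.toEquiv ⟨x, hx⟩ : G) ^ n := by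
  subst h
  exact congrArg Subtype.val (map_pow α.toEquiv ⟨x, hx⟩ n)

theorem preimage_isPrimeToPowFull {α : FinIndexIso G} {K : Subgroup G} {p : ℕ}
    (hα : α.dom.IsPrimeToPowFull p) (hK : K.IsPrimeToPowFull p) :
    (α.preimage K).IsPrimeToPowFull p := by
  intro x
  obtain ⟨m, hm, hx⟩ := hα x
  obtain ⟨n, hn, hy⟩ := hK (α.toEquiv ⟨x ^ m, hx⟩ : G)
  have hmem : x ^ (m * n) ∈ α.dom := pow_mul x m n ▸ pow_mem hx n
  refine ⟨m * n, hm.mul_left hn, mem_preimage.2 ⟨hmem, ?_⟩⟩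
  rwa [α.apply_pow hx n hmem (pow_mul x m n)]

end FinIndexIso

namespace AbstractCommensurator

/-- The classes of isomorphisms between subgroups into which every element of `G` has a power
with exponent prime to `p`. -/
def primeTo (G : Type*) [Group G] (p : ℕ) : Subgroup (AbstractCommensurator G) where
  carrier := {u | ∃ α : FinIndexIso G, Quotient.mk _ α = u ∧
    α.dom.IsPrimeToPowFull p ∧ α.cod.IsPrimeToPowFull p}
  one_mem' := ⟨FinIndexIso.refl G, rfl, fun _ => ⟨1, Nat.coprime_one_left p, trivial⟩,
    fun _ => ⟨1, Nat.coprime_one_left p, trivial⟩⟩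
  mul_mem' := by
    rintro _ _ ⟨α, rfl, hα, hα'⟩ ⟨β, rfl, hβ, hβ'⟩
    exact ⟨α.comp β, rfl, FinIndexIso.preimage_isPrimeToPowFull hα hβ,
      FinIndexIso.preimage_isPrimeToPowFull (α := β.symm) hβ' hα'⟩
  inv_mem' := by
    rintro _ ⟨α, rfl, hα, hα'⟩
    exact ⟨α.symm, rfl, hα', hα⟩

theorem primeTo_eq_top_of_fg (h : Group.FG (AbstractCommensurator G)) :
    ∃ N : ℕ, ∀ p : ℕ, p.Prime → N < p → primeTo G p = ⊤ := by
  obtain ⟨S, hS⟩ := Group.fg_iff'.1 h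
  obtain ⟨S, -, hS⟩ := hS
  let d : AbstractCommensurator G → ℕ := fun u => u.out.dom.index + u.out.cod.index
  refine ⟨S.sup d, fun p hp hN => top_unique (hS ▸ (Subgroup.closure_le _).2 fun u hu => ?_)⟩
  have hd : u.out.dom.index + u.out.cod.index < p := (Finset.le_sup (f := d) hu).trans_lt hN
  exact ⟨u.out, Quotient.out_eq u,
    Subgroup.isPrimeToPowFull_of_index_lt u.out.dom_finiteIndex hp (by omega),
    Subgroup.isPrimeToPowFull_of_index_lt u.out.cod_finiteIndex hp (by omega)⟩

end AbstractCommensurator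

/-- An automorphism of a subgroup of finite index of `G` maps some `x ^ p` to an element which,
up to exponents prime to `p`, has no `p`-th root in `G`. -/
def DestroysRoot (G : Type*) [Group G] (p : ℕ) : Prop :=
  ∃ (K : Subgroup G) (F : K ≃* K) (x : G) (hx : x ^ p ∈ K), K.FiniteIndex ∧
    ∀ (z : G) (m M : ℕ), m.Coprime p → 0 < M → z ^ (p * M) ≠ (F ⟨x ^ p, hx⟩ : G) ^ (m * M)

theorem DestroysRoot.of_mulEquiv {G' : Type*} [Group G'] (e : G ≃* G') {p : ℕ}
    (h : DestroysRoot G p) : DestroysRoot G' p := by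
  obtain ⟨K, F, x, hx, hK, h⟩ := h
  have hx' : (e x) ^ p ∈ K.map (e : G →* G') := ⟨x ^ p, hx, map_pow e x p⟩
  refine ⟨K.map (e : G →* G'), ((e.subgroupMap K).symm.trans F).trans (e.subgroupMap K), e x, hx',
    ⟨?_⟩, fun z m M hm hM hz => h (e.symm z) m M hm hM ?_⟩
  · rw [Subgroup.index_map_equiv]
    exact hK.index_ne_zero
  · have h1 : (e.subgroupMap K).symm ⟨e x ^ p, hx'⟩ = ⟨x ^ p, hx⟩ := by
      rw [MulEquiv.symm_apply_eq]
      exact Subtype.ext (map_pow e x p).symm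
    rw [MulEquiv.trans_apply, MulEquiv.trans_apply, h1, MulEquiv.coe_subgroupMap_apply] at hz
    rw [← map_pow, hz, map_pow, e.symm_apply_apply]

/-- A representative α of the class of F would provide z = α (x ^ m). As α and F agree only on a
smaller subgroup, a further exponent M is needed to compare them. -/
theorem DestroysRoot.primeTo_ne_top {p : ℕ} (h : DestroysRoot G p) :
    AbstractCommensurator.primeTo G p ≠ ⊤ := by
  obtain ⟨K, F, x, hx, hK, h⟩ := h
  intro htop
  let φ : FinIndexIso G := ⟨K, K, hK, hK, F⟩
  have hmem (u : AbstractCommensurator G) : u ∈ AbstractCommensurator.primeTo G p :=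
    htop ▸ Subgroup.mem_top u
  obtain ⟨α, hαφ, hα, -⟩ := hmem (Quotient.mk _ φ)
  obtain ⟨L, hL, h1, h2, hagree⟩ : α.Rel φ := Quotient.exact hαφ
  obtain ⟨m, hm, hxm⟩ := hα x
  obtain ⟨M, hM, -, hLM⟩ :=
    Subgroup.exists_pow_mem_of_index_ne_zero hL.index_ne_zero (x ^ (m * p))
  refine h (α.toEquiv ⟨x ^ m, hxm⟩) m M hm hM ?_
  have e1 := α.apply_pow hxm (p * M) (h1 hLM) (by rw [← pow_mul, ← pow_mul, mul_assoc])
  have e2 := φ.apply_pow hx (m * M) (h2 hLM) (by rw [← pow_mul, ← pow_mul]; ring_nf)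
  exact e1.symm.trans ((hagree _ hLM).trans e2)

theorem not_fg_of_forall_destroysRoot (h : ∀ N : ℕ, ∃ p, p.Prime ∧ N < p ∧ DestroysRoot G p) :
    ¬ Group.FG (AbstractCommensurator G) := by
  intro hfg
  obtain ⟨N, hN⟩ := AbstractCommensurator.primeTo_eq_top_of_fg hfg
  obtain ⟨p, hp, hlt, hd⟩ := h N
  exact hd.primeTo_ne_top (hN p hp hlt)

end Commensurator

/-! ### The free product -/

open Monoid Coprod in
theorem destroysRoot_coprod {A B : Type*} [Group A] [Group B] [Nontrivial B]
    (hA : HasUniqueRoots A) (hB : HasUniqueRoots B) {K : Subgroup A} [K.Normal]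
    (hp : (Nat.card (A ⧸ K)).Prime) (h2 : 2 < Nat.card (A ⧸ K)) :
    DestroysRoot (A ∗ B) (Nat.card (A ⧸ K)) := by
  have := (hasUniqueRoots_iff_isMulTorsionFree A).1 hA
  have := (hasUniqueRoots_iff_isMulTorsionFree B).1 hB
  have : Finite (A ⧸ K) := Nat.finite_of_card_ne_zero hp.ne_zero
  have : Nontrivial (A ⧸ K) := Finite.one_lt_card_iff_nontrivial.1 hp.one_lt
  obtain ⟨n, hn⟩ : ∃ n, Nat.card (A ⧸ K) = n + 1 := ⟨_, (Nat.succ_pred hp.ne_zero).symm⟩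
  obtain ⟨q, hq⟩ := exists_ne (1 : A ⧸ K)
  obtain ⟨a, rfl⟩ := QuotientGroup.mk'_surjective K q
  obtain ⟨b, hb⟩ := exists_ne (1 : B)
  have ha : a ≠ 1 := fun h => hq (by rw [h, map_one])
  have hord : orderOf (QuotientGroup.mk' K a) = n + 1 := by
    rw [← hn]
    refine ((Nat.dvd_prime hp).1 (orderOf_dvd_natCard _)).resolve_left fun h => hq ?_
    exact orderOf_eq_one_iff.1 h
  have hc : QuotientGroup.mk' K (a ^ (n + 1)) = 1 := by
    rw [map_pow, ← hord, pow_orderOf_eq_one]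
  -- The conjugator c = a ^ p lies in ker ρ, yet is nontrivial because A is torsion-free.
  have hc1 : a ^ (n + 1) ≠ 1 := fun h => ha ((pow_eq_one_iff_left (Nat.succ_ne_zero n)).1 h)
  rw [hn] at hp h2 ⊢
  have hx : (inl a * inr b : A ∗ B) ^ (n + 1) ∈ (killRight (QuotientGroup.mk' K)).ker := by
    rw [MonoidHom.mem_ker, map_pow, map_mul, killRight, Coprod.lift_apply_inl,
      Coprod.lift_apply_inr, MonoidHom.one_apply, mul_one, ← map_pow, hc]
  refine ⟨_, twistKer (QuotientGroup.mk' K) hc, inl a * inr b, hx, inferInstance,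
    fun z m M hm hM hz => ?_⟩
  have hm0 : m ≠ 0 := by
    rintro rfl
    exact hp.one_lt.ne' ((Nat.coprime_zero_left _).1 hm)
  let θ : A ∗ B →* finiteSupportWreath A B :=
    (coprodToWreath A B).codRestrict _ coprodToWreath_mem
  have hz' : (z ^ (n + 1)) ^ M = (((inl a * inr b) ^ n *
      (inl (a * a ^ (n + 1)) * inr b * inl (a ^ (n + 1))⁻¹) : A ∗ B) ^ m) ^ M := by
    rw [← twist_pow_orderOf_left _ _ _ _ _ hord, ← pow_mul, ← pow_mul]
    exact hz
  have hθ := congrArg θ hz'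
  -- Unique roots in the wreath product cancel M; coprimality then removes m.
  rw [map_pow θ _ M, map_pow θ _ M] at hθ
  have hθ' := pow_left_injective hM.ne' hθ
  rw [map_pow θ, map_pow θ _ m] at hθ'
  obtain ⟨w, hw⟩ := exists_pow_eq_of_pow_eq_pow hm0 hm hθ'
  exact not_isPow_of_finiteSupport hc1 hb (by omega) w.2 (congrArg Subtype.val hw)

theorem mainTheorem6 {A B : Type*} [Group A] [Group B] [Nontrivial A] [Nontrivial B]
    (hA : HasUniqueRoots A) (hB : HasUniqueRoots B)
    (hAB : HasArbitrarilyLargePrimeQuotients A ∨ HasArbitrarilyLargePrimeQuotients B) :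
    ¬ Group.FG (AbstractCommensurator (Monoid.Coprod A B)) := by
  refine not_fg_of_forall_destroysRoot fun N => ?_
  rcases hAB with h | h
  -- The 2 excludes p = 2, for which n = p - 1 would be too small.
  · obtain ⟨K, hK, hp, hN⟩ := h (max N 2)
    exact ⟨_, hp, (le_max_left _ _).trans_lt hN,
      destroysRoot_coprod hA hB hp ((le_max_right _ _).trans_lt hN)⟩
  · obtain ⟨K, hK, hp, hN⟩ := h (max N 2)
    exact ⟨_, hp, (le_max_left _ _).trans_lt hN,
      (destroysRoot_coprod hB hA hp ((le_max_right _ _).trans_lt hN)).of_mulEquiv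
        (MulEquiv.coprodComm B A)⟩
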